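/- Let $d,k\ge 1$ be integers, let $u_1,\ldots,u_k\in S^{d-1}$ be unit vectors in $\mathbb{R}^d$, and let $r_1,\ldots,r_k\in\{1,\ldots,d-1\}$ satisfy $r_1+\cdots+r_k\ge (k-1)d$. For a unit vector $u$ and $0\le j\le d-1$ let $G^{u^\perp}(d-1,j)$ be the Grassmannian of $j$-dimensional linear subspaces of the hyperplane $u^\perp$, with its usual topology, and let $\nu^{d-1}_j$ be its Haar probability measure, i.e. the unique Borel probability measure invariant under the orthogonal group of $u^\perp$. Each subspace $A$ is identified with an associated unit simple multivector, that is, $v_1\wedge\cdots\wedge v_j$ for an orthonormal basis $v_1,\ldots,v_j$ of $A$ (unique up to the sign, which does not matter below); $\langle\cdot,\cdot\rangle$ and $\|\cdot\|$ denote the standard scalar product and norm of multivectors, so that $\langle v_1\wedge\cdots\wedge v_m,w_1\wedge\cdots\wedge w_m\rangle=\det(\langle v_a,w_b\rangle)_{a,b}$. Then there exists a continuous function $$\Psi_{u_1,\ldots,u_k}:\ G^{u_1^\perp}(d-1,d-1-r_1)\times\cdots\times G^{u_k^\perp}(d-1,d-1-r_k)\to\mathbb{R}$$ such that for all $A_1\in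 G^{u_1^\perp}(d-1,d-1-r_1),\ldots,A_k\in G^{u_k^\perp}(d-1,d-1-r_k)$, $$\int\cdots\int\Psi_{u_1,\ldots,u_k}(U_1,\ldots,U_k)\,\langle U_1,A_1\rangle^2\cdots\langle U_k,A_k\rangle^2\,dU_1\cdots dU_k=\|A_1\wedge u_1\wedge\cdots\wedge A_k\wedge u_k\|^2,$$ where $dU_i=\nu^{d-1}_{d-1-r_i}(dU_i)$ denotes integration over $U_i\in G^{u_i^\perp}(d-1,d-1-r_i)$. -/

import Mathlib

open MeasureTheory Module

noncomputable section

namespace FlagRep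

section General

variable (F : Type*) [NormedAddCommGroup F] [InnerProductSpace ℝ F] [FiniteDimensional ℝ F]
  [CompleteSpace F]

/-- The Grassmannian of `j`-dimensional linear subspaces of the Euclidean space `F`. -/
def Gr (j : ℕ) : Type _ := {U : Submodule ℝ F // finrank ℝ U = j}

variable {F}

/-- The orthogonal projection of `F` onto a subspace, as an operator on `F`. -/
def Gr.proj {j : ℕ} (U : Gr F j) : F →L[ℝ] F := U.1.starProjection

/-- The usual topology of the Grassmannian: subspaces are close when their orthogonal projections
are close in operator norm. -/
instance Gr.instTopologicalSpace (j : ℕ) : TopologicalSpace (Gr F j) :=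
  TopologicalSpace.induced Gr.proj inferInstance

instance Gr.instMeasurableSpace (j : ℕ) : MeasurableSpace (Gr F j) := borel _

instance Gr.instBorelSpace (j : ℕ) : BorelSpace (Gr F j) := ⟨rfl⟩

variable (F)

/-- The orthogonal group `O(F)`, with the topology of the operator norm. -/
abbrev OrthGroup : Type _ := unitary (F →L[ℝ] F)

instance : MeasurableSpace (OrthGroup F) := borel _

instance : BorelSpace (OrthGroup F) := ⟨rfl⟩

instance : CompactSpace (OrthGroup F) := by
  apply isCompact_iff_compactSpace.mp
  have : ProperSpace (F →L[ℝ] F) := FiniteDimensional.proper ℝ _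
  refine Metric.isCompact_of_isClosed_isBounded isClosed_unitary ?_
  refine (Metric.isBounded_closedBall (x := (0 : F →L[ℝ] F)) (r := 1)).subset ?_
  intro g hg
  rw [mem_closedBall_zero_iff]
  exact ContinuousLinearMap.opNorm_le_bound _ zero_le_one fun x =>
    ((Unitary.linearIsometryEquiv (⟨g, hg⟩ : OrthGroup F)).norm_map x).trans_le (one_mul _).ge

/-- The Haar probability measure on the orthogonal group. -/
def haarOrth : Measure (OrthGroup F) :=
  Measure.haarMeasure (⊤ : TopologicalSpace.PositiveCompacts (OrthGroup F))

variable {F}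

/-- The image `g U` of a subspace under an orthogonal transformation. -/
def Gr.rotate {j : ℕ} (U : Gr F j) (g : OrthGroup F) : Gr F j :=
  ⟨U.1.map ((Unitary.linearIsometryEquiv g).toLinearEquiv : F →ₗ[ℝ] F),
    (LinearEquiv.finrank_map_eq _ _).trans U.2⟩

variable (F)

open Classical in
/-- The Haar probability measure on the Grassmannian: the image of the Haar probability measure of
the orthogonal group under `g ↦ g U₀`, where `U₀` is a fixed `j`-dimensional subspace (`O(F)` acts
transitively, so that the choice of `U₀` does not matter). -/
def grMeasure (j : ℕ) : Measure (Gr F j) :=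
  if h : Nonempty (Gr F j) then (haarOrth F).map h.some.rotate else 0

variable {F}

lemma Gr.continuous_rotate {j : ℕ} (U : Gr F j) : Continuous U.rotate := by
  refine continuous_induced_rng.mpr ?_
  have h : (Gr.proj ∘ U.rotate) = fun g : OrthGroup F =>
      (g : F →L[ℝ] F) * U.proj * (star g : OrthGroup F) := by
    funext g
    ext x
    exact Submodule.starProjection_map_apply (Unitary.linearIsometryEquiv g) U.1 x
  rw [h]
  fun_prop

instance : IsProbabilityMeasure (haarOrth F) :=
  ⟨Measure.haarMeasure_self (K₀ := (⊤ : TopologicalSpace.PositiveCompacts (OrthGroup F)))⟩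

lemma isProbabilityMeasure_grMeasure {j : ℕ} (hj : j ≤ finrank ℝ F) :
    IsProbabilityMeasure (grMeasure F j) := by
  have h : Nonempty (Gr F j) := by
    obtain ⟨v, hv⟩ := exists_linearIndependent_of_le_finrank hj
    exact ⟨⟨Submodule.span ℝ (Set.range v), (finrank_span_eq_card hv).trans (Fintype.card_fin j)⟩⟩
  rw [grMeasure, dif_pos h]
  exact Measure.isProbabilityMeasure_map (Gr.continuous_rotate _).measurable.aemeasurable

/-- A unit simple multivector `v₁ ∧ ⋯ ∧ vⱼ` associated with a subspace, where `v₁, …, vⱼ` is an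
orthonormal basis of it. It is unique up to the sign, and is used only in expressions in which the
sign cancels. -/
def Gr.multivector {j : ℕ} (U : Gr F j) : ⋀[ℝ]^j F :=
  exteriorPower.ιMulti ℝ j
    (fun l => (((stdOrthonormalBasis ℝ U.1).reindex (finCongr U.2) l : U.1) : F))

/-- The Euclidean norm on the full exterior algebra, which is the orthogonal direct sum of the
exterior powers of `F` with their standard scalar products. -/
def wedgeNorm (ξ : ExteriorAlgebra ℝ F) : ℝ :=
  Real.sqrt (∑ n ∈ Finset.range (finrank ℝ F + 1),
    ‖DirectSum.decompose (fun i : ℕ => ⋀[ℝ]^i F) ξ n‖ ^ 2)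

end General

/-- The orthogonal complement `u^⊥` of a unit vector in `ℝ^d`. -/
abbrev perp {d : ℕ} (u : Metric.sphere (0 : EuclideanSpace ℝ (Fin d)) 1) :
    Submodule ℝ (EuclideanSpace ℝ (Fin d)) :=
  (Submodule.span ℝ {(u : EuclideanSpace ℝ (Fin d))})ᗮ

/-- The multivector `A ∧ u` of `ℝ^d`, for a linear subspace `A` of `u^⊥`. -/
def wedgeNormal {d j : ℕ} (u : Metric.sphere (0 : EuclideanSpace ℝ (Fin d)) 1)
    (A : Gr (perp u) j) : ExteriorAlgebra ℝ (EuclideanSpace ℝ (Fin d)) :=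
  ExteriorAlgebra.map (perp u).subtype (A.multivector : ExteriorAlgebra ℝ (perp u)) *
    ExteriorAlgebra.ι ℝ (u : EuclideanSpace ℝ (Fin d))

end FlagRep

end

namespace FlagRep

/-! With `φ(A) = (A₁ ⊗ ⋯ ⊗ A_k)^{⊗2}`, the kernel `∏ ⟨Uᵢ, Aᵢ⟩²` is `⟨φ(U), φ(A)⟩`, and the
right-hand side, quadratic in `A₁ ⊗ ⋯ ⊗ A_k`, is `L(φ(A))` for a linear `L`. On the
finite-dimensional span of the image of `φ`, the form `∫ ⟨φ, v⟩⟨φ, w⟩` is positive definite, because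
the product measure charges every nonempty open set. It therefore represents `L` by a vector `w`,
and `Ψ = ⟨φ(·), w⟩` works. `φ` is continuous although the choice of multivectors need not be: signs
cancel in the square. -/

theorem exists_integral_inner_mul_inner_eq {X E : Type*} [TopologicalSpace X] [CompactSpace X]
    [MeasurableSpace X] [OpensMeasurableSpace X] (μ : Measure X) [IsFiniteMeasure μ]
    [μ.IsOpenPosMeasure] [NormedAddCommGroup E] [InnerProductSpace ℝ E] [FiniteDimensional ℝ E]
    {φ : X → E} (hφ : Continuous φ) (L : E →ₗ[ℝ] ℝ) :
    ∃ w : E, ∀ a, ∫ x, inner ℝ (φ x) w * inner ℝ (φ x) (φ a) ∂μ = L (φ a) := by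
  have hint : ∀ v w : E, Integrable (fun x => inner ℝ (φ x) v * inner ℝ (φ x) w) μ := fun v w =>
    Continuous.integrable_of_hasCompactSupport
      ((hφ.inner continuous_const).mul (hφ.inner continuous_const)) (HasCompactSupport.of_compactSpace _)
  -- The form vanishes on vectors orthogonal to the range of `φ`, so nondegeneracy can only hold on
  -- the span.
  let S := Submodule.span ℝ (Set.range φ)
  let T : S →ₗ[ℝ] Dual ℝ S := LinearMap.mk₂ ℝ
    (fun v w : S => ∫ x, inner ℝ (φ x) (v : E) * inner ℝ (φ x) (w : E) ∂μ)
    (fun v v' w => by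
      simp only [Submodule.coe_add, inner_add_right, add_mul]
      exact integral_add (hint _ _) (hint _ _))
    (fun c v w => by
      simp only [Submodule.coe_smul, inner_smul_right, mul_assoc]
      exact integral_const_mul _ _)
    (fun v w w' => by
      simp only [Submodule.coe_add, inner_add_right, mul_add]
      exact integral_add (hint _ _) (hint _ _))
    (fun c v w => by
      simp only [Submodule.coe_smul, inner_smul_right, mul_left_comm _ c]
      exact integral_const_mul _ _)
  have hinj : Function.Injective T := by
    refine (injective_iff_map_eq_zero T).mpr fun v hv => ?_
    have h0 : ∫ x, inner ℝ (φ x) (v : E) * inner ℝ (φ x) (v : E) ∂μ = 0 := DFunLike.congr_fun hv v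
    have hae := (integral_eq_zero_iff_of_nonneg (fun x => mul_self_nonneg _) (hint v v)).mp h0
    have hzero := (Continuous.ae_eq_iff_eq μ
      ((hφ.inner continuous_const).mul (hφ.inner continuous_const)) continuous_const).mp hae
    have horth : ∀ s ∈ S, inner ℝ s (v : E) = 0 := fun s hs => by
      induction hs using Submodule.span_induction with
      | mem s hs =>
        obtain ⟨x, rfl⟩ := hs
        exact mul_self_eq_zero.mp (congrFun hzero x)
      | zero => exact inner_zero_left _
      | add s t _ _ hs ht => rw [inner_add_left, hs, ht, add_zero]
      | smul c s _ hs => rw [inner_smul_left, hs, mul_zero]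
    exact Subtype.ext (inner_self_eq_zero.mp (horth v v.2))
  obtain ⟨w, hw⟩ := (LinearMap.injective_iff_surjective_of_finrank_eq_finrank
    Subspace.dual_finrank_eq.symm).mp hinj (L ∘ₗ S.subtype)
  exact ⟨w, fun a => DFunLike.congr_fun hw ⟨φ a, Submodule.subset_span ⟨a, rfl⟩⟩⟩

section Grassmannian

variable {F : Type*} [NormedAddCommGroup F] [InnerProductSpace ℝ F] [FiniteDimensional ℝ F]
  {j : ℕ}

lemma Gr.continuous_proj : Continuous (Gr.proj : Gr F j → F →L[ℝ] F) :=
  continuous_induced_dom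

instance : SecondCountableTopology (Gr F j) :=
  (Topology.IsInducing.mk rfl : Topology.IsInducing (Gr.proj (F := F) (j := j))).secondCountableTopology

/-- Multiplicativity of the determinant, with `∑ vᵢ ⊗ vᵢ` being the projection onto `A`: the chosen
basis drops out. -/
lemma Gr.inner_ιMulti_mul_inner_ιMulti (A : Gr F j) (x y : Fin j → F) :
    inner ℝ (exteriorPower.ιMulti ℝ j x) A.multivector *
      inner ℝ (exteriorPower.ιMulti ℝ j y) A.multivector =
    (Matrix.of fun a b => inner ℝ (x a) (A.proj (y b))).det := by
  let v := (stdOrthonormalBasis ℝ A.1).reindex (finCongr A.2)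
  rw [Gr.multivector, exteriorPower.inner_ιMulti_ιMulti, exteriorPower.inner_ιMulti_ιMulti,
    ← Matrix.det_transpose, ← Matrix.det_mul]
  congr 1
  ext a b
  have hP : A.proj (y b) = ∑ i, inner ℝ (v i : F) (y b) • (v i : F) := by
    rw [Gr.proj, v.starProjection_eq_sum_rankOne]
    simp
  rw [Matrix.of_apply, hP, inner_sum, Matrix.mul_apply]
  refine Finset.sum_congr rfl fun i _ => ?_
  rw [inner_smul_right, real_inner_comm (y b), mul_comm]
  rfl

lemma Gr.continuous_inner_mul_inner (ξ η : ⋀[ℝ]^j F) :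
    Continuous fun A : Gr F j => inner ℝ ξ A.multivector * inner ℝ η A.multivector := by
  have hξ : ξ ∈ Submodule.span ℝ (Set.range (exteriorPower.ιMulti ℝ j (M := F))) := by
    rw [exteriorPower.ιMulti_span]; trivial
  have hη : η ∈ Submodule.span ℝ (Set.range (exteriorPower.ιMulti ℝ j (M := F))) := by
    rw [exteriorPower.ιMulti_span]; trivial
  induction hξ using Submodule.span_induction with
  | mem s hs =>
    obtain ⟨x, rfl⟩ := hs
    induction hη using Submodule.span_induction with
    | mem t ht =>
      obtain ⟨y, rfl⟩ := ht
      simp only [Gr.inner_ιMulti_mul_inner_ιMulti]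
      have := Gr.continuous_proj (F := F) (j := j)
      refine Continuous.matrix_det (continuous_matrix fun a b => ?_)
      exact continuous_const.inner (this.clm_apply continuous_const)
    | zero => simpa using continuous_const
    | add s t _ _ hs ht => simpa only [inner_add_left, mul_add] using Continuous.fun_add hs ht
    | smul c s _ hs =>
      simpa only [inner_smul_left, mul_left_comm _ (starRingEnd ℝ c)] using hs.const_mul _
  | zero => simpa using continuous_const
  | add s t _ _ hs ht => simpa only [inner_add_left, add_mul] using Continuous.fun_add hs ht
  | smul c s _ hs => simpa only [inner_smul_left, mul_assoc] using hs.const_mul _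

variable [CompleteSpace F]

/-- The orthogonal group acts transitively on the Grassmannian. -/
lemma Gr.rotate_surjective (U : Gr F j) : Function.Surjective U.rotate := by
  intro W
  let e : U.1 ≃ₗᵢ[ℝ] W.1 := ((stdOrthonormalBasis ℝ U.1).reindex (finCongr (U.2.trans W.2.symm))).equiv
    (stdOrthonormalBasis ℝ W.1) (Equiv.refl _)
  -- An isometry `U → W` extends to all of `F`, and is onto there by dimension.
  let f : F →ₗᵢ[ℝ] F := (W.1.subtypeₗᵢ.comp e.toLinearIsometry).extend
  have hf : ∀ x : U.1, f x = e x := LinearIsometry.extend_apply _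
  refine ⟨Unitary.linearIsometryEquiv.symm (f.toLinearIsometryEquiv rfl), Subtype.ext ?_⟩
  ext y
  simp only [Gr.rotate, MulEquiv.apply_symm_apply, Submodule.mem_map]
  constructor
  · rintro ⟨x, hx, rfl⟩
    exact (hf ⟨x, hx⟩).symm ▸ (e ⟨x, hx⟩).2
  · intro hy
    refine ⟨e.symm ⟨y, hy⟩, (e.symm ⟨y, hy⟩).2, (hf _).trans ?_⟩
    rw [e.apply_symm_apply]

instance : CompactSpace (Gr F j) := by
  rcases isEmpty_or_nonempty (Gr F j) with h | ⟨⟨U⟩⟩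
  · infer_instance
  · exact U.rotate_surjective.compactSpace U.continuous_rotate

instance : IsFiniteMeasure (grMeasure F j) := by
  unfold grMeasure
  split_ifs <;> infer_instance

instance : (haarOrth F).IsOpenPosMeasure := by
  unfold haarOrth
  infer_instance

/-- Full support passes from Haar measure to its image under a continuous surjection, here the
transitive orbit map. -/
instance : (grMeasure F j).IsOpenPosMeasure := by
  by_cases h : Nonempty (Gr F j)
  · rw [grMeasure, dif_pos h]
    exact (Gr.continuous_rotate _).isOpenPosMeasure_map (Gr.rotate_surjective _)
  · exact ⟨fun _ _ hU => absurd ⟨hU.some⟩ h⟩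

end Grassmannian

section Wedge

variable {F : Type*} [NormedAddCommGroup F] [InnerProductSpace ℝ F] [FiniteDimensional ℝ F]

variable (F) in
/-- The standard scalar product of multivectors, as a bilinear form on the exterior algebra. -/
noncomputable def wedgeForm : ExteriorAlgebra ℝ F →ₗ[ℝ] ExteriorAlgebra ℝ F →ₗ[ℝ] ℝ :=
  ∑ n ∈ Finset.range (finrank ℝ F + 1),
    (innerₗ (⋀[ℝ]^n F)).compl₁₂
      (DirectSum.component ℝ ℕ (fun i => ⋀[ℝ]^i F) n ∘ₗ
        (DirectSum.decomposeLinearEquiv (fun i : ℕ => ⋀[ℝ]^i F)).toLinearMap)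
      (DirectSum.component ℝ ℕ (fun i => ⋀[ℝ]^i F) n ∘ₗ
        (DirectSum.decomposeLinearEquiv (fun i : ℕ => ⋀[ℝ]^i F)).toLinearMap)

lemma wedgeForm_self (ξ : ExteriorAlgebra ℝ F) : wedgeForm F ξ ξ = wedgeNorm ξ ^ 2 := by
  rw [wedgeNorm, Real.sq_sqrt (Finset.sum_nonneg fun _ _ => sq_nonneg _)]
  simp only [wedgeForm, LinearMap.sum_apply]
  exact Finset.sum_congr rfl fun n _ =>
    real_inner_self_eq_norm_sq (DirectSum.decompose (fun i : ℕ => ⋀[ℝ]^i F) ξ n)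

/-- Wedging a multivector of `u^⊥` with `u`, as a linear map. -/
noncomputable def wedgeNormalₗ {d : ℕ} (u : Metric.sphere (0 : EuclideanSpace ℝ (Fin d)) 1)
    (j : ℕ) : ⋀[ℝ]^j (perp u) →ₗ[ℝ] ExteriorAlgebra ℝ (EuclideanSpace ℝ (Fin d)) :=
  LinearMap.mulRight ℝ (ExteriorAlgebra.ι ℝ (u : EuclideanSpace ℝ (Fin d))) ∘ₗ
    (ExteriorAlgebra.map (perp u).subtype).toLinearMap ∘ₗ (⋀[ℝ]^j (perp u)).subtype

end Wedge

open Classical in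
theorem exists_continuous_integral_prod_inner_sq_eq {ι : Type*} [Fintype ι] {X E : ι → Type*}
    [∀ i, TopologicalSpace (X i)] [∀ i, CompactSpace (X i)]
    [∀ i, SecondCountableTopology (X i)] [∀ i, MeasurableSpace (X i)] [∀ i, BorelSpace (X i)]
    (μ : ∀ i, Measure (X i)) [∀ i, IsFiniteMeasure (μ i)] [∀ i, (μ i).IsOpenPosMeasure]
    [∀ i, NormedAddCommGroup (E i)] [∀ i, InnerProductSpace ℝ (E i)]
    [∀ i, FiniteDimensional ℝ (E i)] {W : Type*} [AddCommGroup W] [Module ℝ W]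
    (M : MultilinearMap ℝ E W) (B : W →ₗ[ℝ] W →ₗ[ℝ] ℝ) (f : ∀ i, X i → E i)
    (hf : ∀ i ξ η, Continuous fun x => inner ℝ ξ (f i x) * inner ℝ η (f i x)) :
    ∃ Ψ : (∀ i, X i) → ℝ, Continuous Ψ ∧ ∀ A : ∀ i, X i,
      ∫ U, Ψ U * ∏ i, inner ℝ (f i (U i)) (f i (A i)) ^ 2 ∂(Measure.pi μ) =
        B (M fun i => f i (A i)) (M fun i => f i (A i)) := by
  let e (i : ι) := stdOrthonormalBasis ℝ (E i)
  let κ : Type _ := ∀ i, Fin (finrank ℝ (E i))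
  let c : (∀ i, X i) → κ → ℝ := fun A I => ∏ i, inner ℝ (e i (I i)) (f i (A i))
  -- Only products of two coordinates of `f i` are assumed continuous, hence the tensor square.
  let φ : (∀ i, X i) → EuclideanSpace ℝ (κ × κ) :=
    fun A => WithLp.toLp 2 fun p => c A p.1 * c A p.2
  have hφ : Continuous φ := by
    refine (PiLp.continuous_toLp 2 _).comp (continuous_pi fun p => ?_)
    simp only [c, ← Finset.prod_mul_distrib]
    exact continuous_finsetProd _ fun i _ => (hf i _ _).comp (continuous_apply i)
  have hinner : ∀ U A, inner ℝ (φ U) (φ A) = ∏ i, inner ℝ (f i (U i)) (f i (A i)) ^ 2 := by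
    intro U A
    have hc : ∏ i, inner ℝ (f i (U i)) (f i (A i)) = ∑ I, c U I * c A I := by
      simp only [c, ← Finset.prod_mul_distrib]
      rw [← Fintype.prod_sum fun i s =>
        inner ℝ (e i s) (f i (U i)) * inner ℝ (e i s) (f i (A i))]
      refine Finset.prod_congr rfl fun i _ => ?_
      rw [← (e i).sum_inner_mul_inner]
      simp only [real_inner_comm]
    rw [Finset.prod_pow, hc, sq, Finset.sum_mul_sum, ← Fintype.sum_prod_type', PiLp.inner_apply]
    refine Finset.sum_congr rfl fun p _ => ?_
    simp only [φ, RCLike.inner_apply, conj_trivial]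
    ring
  let m : κ → W := fun I => M fun i => e i (I i)
  -- The coefficients come from expanding `B (M ·) (M ·)` in the orthonormal bases `e i`.
  let L : EuclideanSpace ℝ (κ × κ) →ₗ[ℝ] ℝ :=
    ∑ p : κ × κ, B (m p.1) (m p.2) • (EuclideanSpace.proj (𝕜 := ℝ) p).toLinearMap
  have hL : ∀ A, L (φ A) = B (M fun i => f i (A i)) (M fun i => f i (A i)) := by
    intro A
    have hM : (M fun i => f i (A i)) = ∑ I, c A I • m I := by
      have h : (fun i => f i (A i)) = fun i => ∑ s, inner ℝ (e i s) (f i (A i)) • e i s :=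
        funext fun i => ((e i).sum_repr' _).symm
      rw [h, MultilinearMap.map_sum]
      exact Finset.sum_congr rfl fun I _ => M.map_smul_univ _ _
    have hLφ : L (φ A) = ∑ p : κ × κ, B (m p.1) (m p.2) * (c A p.1 * c A p.2) := by
      simp [L, φ]
    rw [hLφ, hM, Fintype.sum_prod_type]
    simp only [map_sum, map_smul, LinearMap.sum_apply, LinearMap.smul_apply, smul_eq_mul]
    rw [Finset.sum_comm]
    simp only [Finset.mul_sum]
    refine Finset.sum_congr rfl fun I _ => Finset.sum_congr rfl fun J _ => ?_
    ring
  obtain ⟨w, hw⟩ := exists_integral_inner_mul_inner_eq (Measure.pi μ) hφ L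
  refine ⟨fun U => inner ℝ (φ U) w, hφ.inner continuous_const, fun A => ?_⟩
  rw [← hL, ← hw]
  simp only [hinner]

end FlagRep

theorem lemma6p1 (d k : ℕ) (hk : 1 ≤ k)
    (u : Fin k → Metric.sphere (0 : EuclideanSpace ℝ (Fin d)) 1)
    (r : Fin k → ℕ) (hr : ∀ i, 1 ≤ r i ∧ r i < d)
    (hsum : (k - 1) * d ≤ ∑ i, r i) :
    ∃ Ψ : ((i : Fin k) → FlagRep.Gr (FlagRep.perp (u i)) (d - 1 - r i)) → ℝ,
      Continuous Ψ ∧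
      ∀ A : (i : Fin k) → FlagRep.Gr (FlagRep.perp (u i)) (d - 1 - r i),
        ∫ U, Ψ U * ∏ i, inner ℝ (U i).multivector (A i).multivector ^ 2
            ∂(Measure.pi fun i => FlagRep.grMeasure (FlagRep.perp (u i)) (d - 1 - r i)) =
          FlagRep.wedgeNorm (List.ofFn fun i => FlagRep.wedgeNormal (u i) (A i)).prod ^ 2 := by
  obtain ⟨Ψ, hΨ, h⟩ := FlagRep.exists_continuous_integral_prod_inner_sq_eq
    (fun i => FlagRep.grMeasure (FlagRep.perp (u i)) (d - 1 - r i))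
    -- The ordered product of the `Aᵢ ∧ uᵢ` is multilinear in the `Aᵢ`.
    ((MultilinearMap.mkPiAlgebraFin ℝ k
      (ExteriorAlgebra ℝ (EuclideanSpace ℝ (Fin d)))).compLinearMap
        fun i => FlagRep.wedgeNormalₗ (u i) (d - 1 - r i))
    (FlagRep.wedgeForm (EuclideanSpace ℝ (Fin d))) (fun _ A => A.multivector)
    fun _ => FlagRep.Gr.continuous_inner_mul_inner
  exact ⟨Ψ, hΨ, fun A => (h A).trans (FlagRep.wedgeForm_self _)⟩
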